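/- Let $\mathcal H$ be a separable complex Hilbert space, $(\Omega,\Sigma)$ a measurable space, and $\mathsf M:\Sigma\to\mathcal L(\mathcal H)$ an observable, i.e. a weakly $\sigma$-additive map with $\mathsf M(X)\ge 0$ for all $X\in\Sigma$ and $\mathsf M(\Omega)=1_{\mathcal H}$. Let $\mu:\Sigma\to[0,1]$ be a probability measure such that $\mu$ and $\mathsf M$ are mutually absolutely continuous: for every $X\in\Sigma$, $\mu(X)=0$ if and only if $\mathsf M(X)=0$. A normal $\mathsf M$-measurement is a quadruple $(\mathcal K,\mathsf P,U,\xi)$, where $\mathcal K$ is a complex Hilbert space, $\mathsf P:\Sigma\to\mathcal L(\mathcal K)$ is a sharp observable (a normalized projection valued measure), $U$ is a unitary operator on the Hilbert space tensor product $\mathcal H\otimes\mathcal K$ and $\xi\in\mathcal K$ is a unit vector, such that $$\mathsf M(X)=Y_\xi^*\,U^*\,(1_{\mathcal H}\otimes \mathsf P(X))\,U\,Y_\xi\qquad\text{for all }X\in\Sigma,$$ where $Y_\xi:\mathcal H\to\mathcal H\otimes\mathcal K$, $Y_\xi\varphi=\varphi\otimes\xi$. Then: 1. There exist a unitary operator $U$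 on $\mathcal H\otimes L^2(\mu)$ and a unit vector $\xi\in L^2(\mu)$ such that $(L^2(\mu),\,X\mapsto\hat\chi_X,\,U,\,\xi)$ is a normal $\mathsf M$-measurement, where $\hat\chi_X$ is the operator of multiplication by the indicator function of $X$ on $L^2(\mu)$. 2. For every normal $\mathsf M$-measurement $(\mathcal K,\mathsf P,U,\xi)$ one has $\dim\mathcal K\ge\dim L^2(\mu)$, where $\dim$ denotes the cardinality of an orthonormal basis. -/

import Mathlib

universe u v w

open MeasureTheory
open scoped TensorProduct InnerProductSpace InnerProduct

noncomputable section

namespace QMeas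


/-! ### Hilbert space dimension -/

section HilbertDim

variable {E : Type u} [NormedAddCommGroup E] [InnerProductSpace ℂ E]

/-- The cardinality of an orthonormal family is at most that of an orthonormal basis. -/
theorem lift_mk_orthonormal_le {ι : Type v} {κ : Type w} (b : HilbertBasis ι ℂ E)
    {c : κ → E} (hc : Orthonormal ℂ c) :
    Cardinal.lift.{v} (Cardinal.mk κ) ≤ Cardinal.lift.{w} (Cardinal.mk ι) := by
  rcases finite_or_infinite ι with hι | hι
  · have := Fintype.ofFinite ι
    have htop : Submodule.span ℂ (Set.range b) = ⊤ := by
      have h1 := b.dense_span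
      have : FiniteDimensional ℂ (Submodule.span ℂ (Set.range b)) :=
        FiniteDimensional.span_of_finite ℂ (Set.finite_range b)
      rwa [(Submodule.closed_of_finiteDimensional
        (Submodule.span ℂ (Set.range b))).submodule_topologicalClosure_eq] at h1
    let B := Module.Basis.mk b.orthonormal.linearIndependent htop.ge
    have h1 := hc.linearIndependent.cardinal_lift_le_rank
    have h2 := B.mk_eq_rank
    have h3 : Cardinal.lift.{max u v} (Cardinal.mk κ) ≤ Cardinal.lift.{max u w} (Cardinal.mk ι) := by
      calc Cardinal.lift.{max u v} (Cardinal.mk κ)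
          = Cardinal.lift.{v} (Cardinal.lift.{u} (Cardinal.mk κ)) := by
            rw [Cardinal.lift_lift]
        _ ≤ Cardinal.lift.{v} (Cardinal.lift.{w} (Module.rank ℂ E)) :=
            Cardinal.lift_le.2 h1
        _ = Cardinal.lift.{w} (Cardinal.lift.{v} (Module.rank ℂ E)) := by
            rw [Cardinal.lift_lift, Cardinal.lift_lift]
        _ = Cardinal.lift.{w} (Cardinal.lift.{u} (Cardinal.mk ι)) := by rw [h2]
        _ = Cardinal.lift.{max u w} (Cardinal.mk ι) := by rw [Cardinal.lift_lift]
    rw [← Cardinal.lift_le.{u}, Cardinal.lift_lift, Cardinal.lift_lift]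
    simpa only [max_comm] using h3
  · have hcov : (⋃ i, {k | ⟪c k, b i⟫_ℂ ≠ 0}) = Set.univ := by
      refine Set.eq_univ_of_forall fun k => ?_
      by_contra hk
      have h0 : ∀ i, ⟪b i, c k⟫_ℂ = 0 := by
        intro i
        by_contra h
        exact hk (Set.mem_iUnion.2 ⟨i, fun h' => h (inner_eq_zero_symm.1 h')⟩)
      have : c k = 0 := by
        apply b.repr.injective
        ext i
        simpa [b.repr_apply_apply] using h0 i
      exact hc.ne_zero k this
    have hcount : ∀ i, ({k | ⟪c k, b i⟫_ℂ ≠ 0}).Countable := by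
      intro i
      have hs := (hc.inner_products_summable (b i)).countable_support
      refine hs.mono fun k hk => ?_
      simpa [Function.mem_support] using hk
    have h1 := Cardinal.mk_iUnion_le_lift (fun i => {k | ⟪c k, b i⟫_ℂ ≠ 0})
    rw [hcov, Cardinal.mk_univ] at h1
    refine h1.trans ?_
    have h2 : (⨆ i, Cardinal.lift.{v} (Cardinal.mk {k | ⟪c k, b i⟫_ℂ ≠ 0})) ≤ Cardinal.aleph0 :=
      ciSup_le' fun i => by
        rw [← Cardinal.lift_aleph0.{v, w}]
        exact Cardinal.lift_le.2 (hcount i).le_aleph0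
    calc _ ≤ Cardinal.lift.{w} (Cardinal.mk ι) * Cardinal.aleph0 := mul_le_mul_right h2 _
      _ = Cardinal.lift.{w} (Cardinal.mk ι) := Cardinal.mul_aleph0_eq (by simp)

variable (E) in
/-- The dimension of a Hilbert space: the cardinality of an orthonormal (Hilbert) basis. -/
def hilbertDim [CompleteSpace E] : Cardinal.{u} :=
  Cardinal.mk (exists_hilbertBasis ℂ E).choose

/-- Every orthonormal basis has cardinality `hilbertDim E`. -/
theorem lift_mk_eq_lift_hilbertDim [CompleteSpace E] {ι : Type v} (b : HilbertBasis ι ℂ E) :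
    Cardinal.lift.{u} (Cardinal.mk ι) = Cardinal.lift.{v} (hilbertDim E) := by
  obtain ⟨b', -⟩ := (exists_hilbertBasis ℂ E).choose_spec
  exact le_antisymm (lift_mk_orthonormal_le b' b.orthonormal)
    (lift_mk_orthonormal_le b b'.orthonormal)

end HilbertDim

/-! ### Tensor products of Hilbert spaces -/

section Tensor

variable (H : Type u) (K : Type v)
  [NormedAddCommGroup H] [InnerProductSpace ℂ H] [NormedAddCommGroup K] [InnerProductSpace ℂ K]

/-- The Hilbert space tensor product `H ⊗ K`: the completion of the algebraic tensor product
with respect to the inner product `⟪φ ⊗ k, φ' ⊗ k'⟫ = ⟪φ, φ'⟫ * ⟪k, k'⟫`. -/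
abbrev HTensor : Type (max u v) := UniformSpace.Completion (H ⊗[ℂ] K)

variable {K}

/-- The bounded operator `1 ⊗ A` on `H ⊗ K`. -/
def idTensor (A : K →L[ℂ] K) : HTensor H K →L[ℂ] HTensor H K :=
  (A.lTensor H).completion

/-- The operator `H → H ⊗ K`, `φ ↦ φ ⊗ ξ`. -/
def tensorVec (ξ : K) : H →L[ℂ] HTensor H K :=
  UniformSpace.Completion.toComplL ∘L (TensorProduct.mkL ℂ H K).flip ξ

theorem idTensor_coe_tmul (A : K →L[ℂ] K) (φ : H) (k : K) :
    idTensor H A ((φ ⊗ₜ[ℂ] k : H ⊗[ℂ] K) : HTensor H K) =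
      ((φ ⊗ₜ[ℂ] A k : H ⊗[ℂ] K) : HTensor H K) :=
  ContinuousLinearMap.completion_apply_coe _ _

theorem tensorVec_apply (ξ : K) (φ : H) :
    tensorVec H ξ φ = ((φ ⊗ₜ[ℂ] ξ : H ⊗[ℂ] K) : HTensor H K) := rfl

end Tensor

/-! ### Observables and normal measurements -/

section Observables

variable {Ω : Type w} [MeasurableSpace Ω]
  {H : Type u} [NormedAddCommGroup H] [InnerProductSpace ℂ H] [CompleteSpace H]
  {K : Type v} [NormedAddCommGroup K] [InnerProductSpace ℂ K] [CompleteSpace K]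

/-- `M` is a (quantum) observable, that is, a normalized positive operator valued measure on the
measurable sets of `Ω`. The values of `M` on non-measurable sets play no role. -/
structure IsObservable (M : Set Ω → H →L[ℂ] H) : Prop where
  isPositive : ∀ X, MeasurableSet X → (M X).IsPositive
  univ : M Set.univ = 1
  /-- weak `σ`-additivity -/
  hasSum : ∀ X : ℕ → Set Ω, (∀ i, MeasurableSet (X i)) →
    Pairwise (fun i j => Disjoint (X i) (X j)) →
      ∀ φ ψ : H, HasSum (fun i => ⟪φ, M (X i) ψ⟫_ℂ) ⟪φ, M (⋃ i, X i) ψ⟫_ℂ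

/-- `P` is a sharp observable (a normalized projection valued measure). -/
structure IsSharpObservable (P : Set Ω → H →L[ℂ] H) : Prop extends IsObservable P where
  isStarProjection : ∀ X, MeasurableSet X → IsStarProjection (P X)

/-- `μ` and `M` are mutually absolutely continuous. -/
def MutuallyAC (μ : Measure Ω) (M : Set Ω → H →L[ℂ] H) : Prop :=
  ∀ X, MeasurableSet X → (μ X = 0 ↔ M X = 0)

/-- `(K, P, U, ξ)` is a normal `M`-measurement: the pointer `P` is a sharp observable on the
apparatus' Hilbert space `K`, `U` is a unitary operator on `H ⊗ K`, `ξ ∈ K` is a unit vector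
(the initial pure state of the apparatus), and the measured observable of the model is `M`, i.e.
`M(X) = Y_ξ* U* (1 ⊗ P(X)) U Y_ξ` for all measurable `X`, where `Y_ξ φ = φ ⊗ ξ`. -/
structure IsNormalMeasurement (M : Set Ω → H →L[ℂ] H) (P : Set Ω → K →L[ℂ] K)
    (U : HTensor H K →L[ℂ] HTensor H K) (ξ : K) : Prop where
  sharp : IsSharpObservable P
  unitary : U ∈ unitary (HTensor H K →L[ℂ] HTensor H K)
  norm_eq_one : ‖ξ‖ = 1
  reproduces : ∀ X, MeasurableSet X →
    M X = (tensorVec H ξ)† ∘L U† ∘L idTensor H (P X) ∘L U ∘L tensorVec H ξ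

end Observables

/-! ### The canonical spectral measure on `L²(μ)` -/

section Canonical

variable {Ω : Type w} [MeasurableSpace Ω] (μ : Measure Ω)

/-- Multiplication by the indicator function of a measurable set, as a linear map on `L²(μ)`. -/
def indicatorMul {X : Set Ω} (hX : MeasurableSet X) : Lp ℂ 2 μ →ₗ[ℂ] Lp ℂ 2 μ where
  toFun f := ((Lp.memLp f).indicator hX).toLp (X.indicator f)
  map_add' f g := by
    rw [← MemLp.toLp_add, MemLp.toLp_eq_toLp_iff]
    filter_upwards [Lp.coeFn_add f g] with x hx
    by_cases h : x ∈ X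
    · simpa [h] using hx
    · simp [h]
  map_smul' c f := by
    rw [RingHom.id_apply, ← MemLp.toLp_const_smul, MemLp.toLp_eq_toLp_iff]
    filter_upwards [Lp.coeFn_smul c f] with x hx
    by_cases h : x ∈ X
    · simpa [h] using hx
    · simp [h]

theorem indicatorMul_apply {X : Set Ω} (hX : MeasurableSet X) (f : Lp ℂ 2 μ) :
    indicatorMul μ hX f = ((Lp.memLp f).indicator hX).toLp (X.indicator f) := rfl

theorem indicatorMul_coeFn {X : Set Ω} (hX : MeasurableSet X) (f : Lp ℂ 2 μ) :
    (indicatorMul μ hX f : Ω → ℂ) =ᵐ[μ] X.indicator f := by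
  rw [indicatorMul_apply]
  exact MemLp.coeFn_toLp _

theorem norm_indicatorMul_le {X : Set Ω} (hX : MeasurableSet X) (f : Lp ℂ 2 μ) :
    ‖indicatorMul μ hX f‖ ≤ 1 * ‖f‖ := by
  rw [one_mul]
  refine Lp.norm_le_norm_of_ae_le ?_
  filter_upwards [indicatorMul_coeFn μ hX f] with x hx
  rw [hx]
  exact norm_indicator_le_norm_self _ _

open Classical in
/-- The canonical spectral measure on `L²(μ)`: a measurable set `X` is sent to the operator
`f ↦ χ_X f` of multiplication by its indicator function (and a non-measurable set to `0`). -/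
def canonicalPVM (X : Set Ω) : Lp ℂ 2 μ →L[ℂ] Lp ℂ 2 μ :=
  if hX : MeasurableSet X then (indicatorMul μ hX).mkContinuous 1 (norm_indicatorMul_le μ hX)
  else 0

theorem canonicalPVM_coeFn {X : Set Ω} (hX : MeasurableSet X) (f : Lp ℂ 2 μ) :
    (canonicalPVM μ X f : Ω → ℂ) =ᵐ[μ] X.indicator f := by
  rw [canonicalPVM, dif_pos hX]
  exact indicatorMul_coeFn μ hX f

end Canonical

end QMeas

end

open QMeas

noncomputable section

namespace QMeas

/-! ### Observables -/

section ObservableLemmas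

variable {Ω : Type w} [MeasurableSpace Ω]
  {H : Type u} [NormedAddCommGroup H] [InnerProductSpace ℂ H]
  {M : Set Ω → H →L[ℂ] H}

/-! Existence. Fix an orthonormal basis `b` of `H`, countable by separability. The entries `⟪b i, M
X (b j)⟫` have densities `m i j` with respect to `μ`, and for almost every point these form a
positive kernel. Pointwise Cholesky factorization gives measurable triangular factors `R n j` with
`m i j = ∑ n, conj (R n i) * R n j`. Triangularity makes these sums finite, and `‖R n j‖² ≤ m j j`
puts the factors in `L²(μ)`. With `c` orthonormal in `H`, the vectors `t j = ∑ n, c n ⊗ R n j`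
satisfy `⟪t i, (1 ⊗ χ_X) t j⟫ = ⟪b i, M X (b j)⟫` (`IsObservable.exists_htensor_gram`); in
particular they are orthonormal. It remains to extend `b i ⊗ ξ ↦ t i` to a unitary, that is, to
match the orthogonal complements. If `H` is finite dimensional, a finite cardinal is cancelled.
Otherwise `c` runs through only half of the basis, which leaves room in the complement
(`exists_unitary_of_infinite`).

Lower bound. Slicing the vectors `U (φ ⊗ ξ)`, with `φ` in a dense sequence, gives countably many `k
n` in `K` such that `M X = 0` iff `P X` kills every `k n` (`IsNormalMeasurement.exists_separating`).
Hence the densities `d n` of `⟪k n, P X (k n)⟫` have supports covering `Ω` up to a `μ`-null set.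
After making the supports disjoint sets `A n`, the map `χ_{X ∩ A n} √(d n) ↦ P (X ∩ A n) (k n)`
preserves inner products and extends to an isometry of `L²(μ)` into `K`. -/

theorem IsObservable.inner_empty (hM : IsObservable M) (φ ψ : H) : ⟪φ, M ∅ ψ⟫_ℂ = 0 := by
  have h := hM.hasSum (fun _ => ∅) (fun _ => MeasurableSet.empty)
    (fun _ _ _ => disjoint_bot_left) φ ψ
  exact tendsto_nhds_unique tendsto_const_nhds h.summable.tendsto_atTop_zero

theorem IsObservable.empty (hM : IsObservable M) : M ∅ = 0 := by
  ext ψ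
  exact ext_inner_left ℂ fun φ => by simp [hM.inner_empty φ ψ]

theorem IsObservable.union (hM : IsObservable M) {X Y : Set Ω} (hX : MeasurableSet X)
    (hY : MeasurableSet Y) (hXY : Disjoint X Y) : M (X ∪ Y) = M X + M Y := by
  ext ψ
  refine ext_inner_left ℂ fun φ => ?_
  let Z : ℕ → Set Ω := fun n => if n = 0 then X else if n = 1 then Y else ∅
  have hZ : ∀ i, MeasurableSet (Z i) := by
    intro i
    simp only [Z]
    split_ifs <;> simp [hX, hY]
  have hd : Pairwise fun i j => Disjoint (Z i) (Z j) := by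
    intro i j hij
    simp only [Z]
    split_ifs <;> first | omega | exact hXY | exact hXY.symm | simp
  have hU : ⋃ i, Z i = X ∪ Y := by
    ext x
    simp only [Set.mem_iUnion, Set.mem_union]
    constructor
    · rintro ⟨i, hi⟩
      simp only [Z] at hi
      split_ifs at hi
      · exact .inl hi
      · exact .inr hi
      · exact hi.elim
    · rintro (h | h)
      · exact ⟨0, h⟩
      · exact ⟨1, h⟩
  have h1 := hM.hasSum Z hZ hd φ ψ
  have h2 : HasSum (fun i => ⟪φ, M (Z i) ψ⟫_ℂ) (∑ i ∈ Finset.range 2, ⟪φ, M (Z i) ψ⟫_ℂ) := by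
    refine hasSum_sum_of_ne_finset_zero fun i hi => ?_
    have h0 : i ≠ 0 := by rintro rfl; simp at hi
    have h1 : i ≠ 1 := by rintro rfl; simp at hi
    simp [Z, h0, h1, hM.inner_empty]
  rw [hU] at h1
  rw [h1.unique h2]
  simp [Finset.sum_range_succ, Z, inner_add_right]

theorem IsObservable.compl (hM : IsObservable M) {X : Set Ω} (hX : MeasurableSet X) :
    M X + M Xᶜ = 1 := by
  rw [← hM.union hX hX.compl disjoint_compl_right, Set.union_compl_self, hM.univ]

/-- The complex measure `X ↦ ⟪φ, M X ψ⟫` has a density with respect to every probability measure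
that dominates it. -/
theorem IsObservable.exists_density (hM : IsObservable M) (μ : Measure Ω) [IsProbabilityMeasure μ]
    (φ ψ : H) (hμ : ∀ X, MeasurableSet X → μ X = 0 → ⟪φ, M X ψ⟫_ℂ = 0) :
    ∃ d : Ω → ℂ, Measurable d ∧ Integrable d μ ∧
      ∀ X, MeasurableSet X → ∫ x in X, d x ∂μ = ⟪φ, M X ψ⟫_ℂ := by
  classical
  have key : ∀ L : ℂ →L[ℝ] ℝ, ∃ d : Ω → ℝ, Measurable d ∧ Integrable d μ ∧
      ∀ X, MeasurableSet X → ∫ x in X, d x ∂μ = L ⟪φ, M X ψ⟫_ℂ := by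
    intro L
    -- A signed measure must vanish off the measurable sets, where `M` is unconstrained.
    let s : SignedMeasure Ω :=
      { measureOf' := fun X => if MeasurableSet X then L ⟪φ, M X ψ⟫_ℂ else 0
        empty' := by simp [hM.inner_empty]
        not_measurable' := fun X hX => if_neg hX
        m_iUnion' := fun X hX hd => by
          simp only [hX, MeasurableSet.iUnion hX, if_true]
          exact L.hasSum (hM.hasSum X hX hd φ ψ) }
    have hs : ∀ X, MeasurableSet X → s X = L ⟪φ, M X ψ⟫_ℂ := fun X hX => if_pos hX
    have hac : s ≪ᵥ μ.toENNRealVectorMeasure := by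
      refine VectorMeasure.AbsolutelyContinuous.mk fun X hX h0 => ?_
      rw [Measure.toENNRealVectorMeasure_apply_measurable hX] at h0
      rw [hs X hX, hμ X hX h0, map_zero]
    refine ⟨s.rnDeriv μ, SignedMeasure.measurable_rnDeriv _ _,
      SignedMeasure.integrable_rnDeriv _ _, fun X hX => ?_⟩
    rw [← withDensityᵥ_apply (SignedMeasure.integrable_rnDeriv _ _) hX,
      SignedMeasure.withDensityᵥ_rnDeriv_eq s μ hac, hs X hX]
  obtain ⟨f, hf, hfi, hfX⟩ := key Complex.reCLM
  obtain ⟨g, hg, hgi, hgX⟩ := key Complex.imCLM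
  have hf' : Integrable (fun x => (f x : ℂ)) μ := hfi.ofReal
  have hg' : Integrable (fun x => (g x : ℂ) * Complex.I) μ := hgi.ofReal.mul_const _
  refine ⟨fun x => f x + g x * Complex.I, by fun_prop, hf'.add hg', fun X hX => ?_⟩
  rw [integral_add hf'.restrict hg'.restrict,
    integral_mul_const, integral_complex_ofReal, integral_complex_ofReal, hfX X hX, hgX X hX]
  exact Complex.re_add_im _

variable [CompleteSpace H]

/-- Idempotency of `P X + P Y` makes `P X` and `P Y` anticommute. Evaluating `P X * P Y * P X` in
two ways then gives `P X * P Y = -(P X * P Y)`. -/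
theorem IsSharpObservable.mul_eq_zero {P : Set Ω → H →L[ℂ] H} (hP : IsSharpObservable P)
    {X Y : Set Ω} (hX : MeasurableSet X) (hY : MeasurableSet Y) (hXY : Disjoint X Y) :
    P X * P Y = 0 := by
  have hx := (hP.isStarProjection X hX).isIdempotentElem
  have hy := (hP.isStarProjection Y hY).isIdempotentElem
  have h := (hP.isStarProjection (X ∪ Y) (hX.union hY)).isIdempotentElem
  rw [hP.union hX hY hXY, IsIdempotentElem.add_iff hx hy] at h
  have h1 : P X * P Y = -(P Y * P X) := eq_neg_of_add_eq_zero_left h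
  have h2 : P X * P Y = P X * P Y * P Y := by rw [mul_assoc, hy.eq]
  have h3 : P X * (P Y * P X) = -(P X * P Y) := by
    rw [← neg_eq_iff_eq_neg.2 h1, mul_neg, ← mul_assoc, hx.eq]
  have h4 : P X * P Y * P X = P X * P Y := by
    have : P X * P Y * P X = -(P Y * P X) := by rw [h1, neg_mul, mul_assoc, hx.eq]
    rw [this, ← h1]
  have h5 : P X * P Y = -(P X * P Y) := by rw [← h3, ← mul_assoc, h4]
  have h6 : (2 : ℂ) • (P X * P Y) = 0 := by
    rw [two_smul]; nth_rewrite 2 [h5]; exact add_neg_cancel _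
  exact (smul_eq_zero.1 h6).resolve_left two_ne_zero

theorem IsSharpObservable.mul_eq_inter {P : Set Ω → H →L[ℂ] H} (hP : IsSharpObservable P)
    {X Y : Set Ω} (hX : MeasurableSet X) (hY : MeasurableSet Y) :
    P X * P Y = P (X ∩ Y) := by
  have hx : P X = P (X ∩ Y) + P (X \ Y) := by
    rw [← hP.union (hX.inter hY) (hX.diff hY) Set.disjoint_sdiff_inter.symm,
      Set.inter_union_sdiff]
  have hy : P Y = P (X ∩ Y) + P (Y \ X) := by
    rw [Set.inter_comm, ← hP.union (hY.inter hX) (hY.diff hX) Set.disjoint_sdiff_inter.symm,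
      Set.inter_union_sdiff]
  have hd := Set.disjoint_sdiff_inter (s := X) (t := Y)
  have hd' : Disjoint (X ∩ Y) (Y \ X) :=
    Set.disjoint_left.2 fun a ha hb => hb.2 ha.1
  have hd'' : Disjoint (X \ Y) (Y \ X) :=
    Set.disjoint_left.2 fun a ha hb => hb.2 ha.1
  rw [hx, hy, mul_add, add_mul, add_mul,
    hP.mul_eq_zero (hX.diff hY) (hX.inter hY) hd,
    hP.mul_eq_zero (hX.inter hY) (hY.diff hX) hd',
    hP.mul_eq_zero (hX.diff hY) (hY.diff hX) hd'',
    (hP.isStarProjection _ (hX.inter hY)).isIdempotentElem.eq]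
  simp

theorem IsSharpObservable.inner_apply_apply {P : Set Ω → H →L[ℂ] H} (hP : IsSharpObservable P)
    {X Y : Set Ω} (hX : MeasurableSet X) (hY : MeasurableSet Y) (φ ψ : H) :
    ⟪P X φ, P Y ψ⟫_ℂ = ⟪φ, P (X ∩ Y) ψ⟫_ℂ := by
  rw [← hP.mul_eq_inter hX hY, mul_apply_eq_comp]
  have := (hP.isStarProjection X hX).isSelfAdjoint
  rw [← ContinuousLinearMap.adjoint_inner_right, this.adjoint_eq]

end ObservableLemmas

/-! ### The canonical spectral measure -/

section CanonicalLemmas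

variable {Ω : Type w} [MeasurableSpace Ω] (μ : Measure Ω)

theorem inner_canonicalPVM {X : Set Ω} (hX : MeasurableSet X) (f g : Lp ℂ 2 μ) :
    ⟪f, canonicalPVM μ X g⟫_ℂ = ∫ x in X, ⟪f x, g x⟫_ℂ ∂μ := by
  rw [L2.inner_def, ← integral_indicator hX]
  refine integral_congr_ae ?_
  filter_upwards [canonicalPVM_coeFn μ hX g] with x hx
  rw [hx]
  by_cases h : x ∈ X <;> simp [h]

theorem canonicalPVM_comp {X Y : Set Ω} (hX : MeasurableSet X) (hY : MeasurableSet Y) :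
    canonicalPVM μ X * canonicalPVM μ Y = canonicalPVM μ (X ∩ Y) := by
  ext1 f
  refine Lp.ext ?_
  rw [mul_apply_eq_comp]
  filter_upwards [canonicalPVM_coeFn μ hX (canonicalPVM μ Y f), canonicalPVM_coeFn μ hY f,
    canonicalPVM_coeFn μ (hX.inter hY) f] with x h1 h2 h3
  rw [h1, h3, ← Set.indicator_indicator]
  by_cases hx : x ∈ X <;> simp [hx, h2]

theorem canonicalPVM_isSharpObservable : IsSharpObservable (canonicalPVM μ) := by
  have hproj : ∀ X, MeasurableSet X → IsStarProjection (canonicalPVM μ X) := by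
    intro X hX
    refine ⟨by rw [IsIdempotentElem, canonicalPVM_comp μ hX hX, Set.inter_self], ?_⟩
    rw [ContinuousLinearMap.isSelfAdjoint_iff_isSymmetric]
    intro f g
    change ⟪canonicalPVM μ X f, g⟫_ℂ = ⟪f, canonicalPVM μ X g⟫_ℂ
    rw [← inner_conj_symm, inner_canonicalPVM μ hX, inner_canonicalPVM μ hX, ← integral_conj]
    simp only [inner_conj_symm]
  refine { isPositive := fun X hX => ?_, univ := ?_, hasSum := ?_, isStarProjection := hproj }
  · exact ContinuousLinearMap.IsPositive.of_isStarProjection (hproj X hX)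
  · ext1 f
    refine Lp.ext ?_
    filter_upwards [canonicalPVM_coeFn μ MeasurableSet.univ f] with x hx
    simpa using hx
  · intro X hX hd f g
    simp only [inner_canonicalPVM μ (hX _), inner_canonicalPVM μ (MeasurableSet.iUnion hX)]
    exact hasSum_integral_iUnion hX hd (L2.integrable_inner f g).integrableOn

end CanonicalLemmas

/-! ### Tensor products -/

section TensorLemmas

variable {H : Type u} {K : Type v}
  [NormedAddCommGroup H] [InnerProductSpace ℂ H] [NormedAddCommGroup K] [InnerProductSpace ℂ K]

/-- The elementary tensor `φ ⊗ k` as an element of the Hilbert space tensor product. -/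
abbrev htmul (φ : H) (k : K) : HTensor H K := ((φ ⊗ₜ[ℂ] k : H ⊗[ℂ] K) : HTensor H K)

theorem inner_htmul (φ ψ : H) (k l : K) :
    ⟪htmul φ k, htmul ψ l⟫_ℂ = ⟪φ, ψ⟫_ℂ * ⟪k, l⟫_ℂ := by
  rw [UniformSpace.Completion.inner_coe, TensorProduct.inner_tmul]

theorem norm_htmul (φ : H) (k : K) : ‖htmul φ k‖ = ‖φ‖ * ‖k‖ := by
  rw [UniformSpace.Completion.norm_coe, TensorProduct.norm_tmul]

theorem htensor_induction {p : HTensor H K → Prop} (hc : IsClosed {x | p x}) (h0 : p 0)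
    (hadd : ∀ x y, p x → p y → p (x + y)) (ht : ∀ φ k, p (htmul φ k)) (x : HTensor H K) : p x := by
  refine UniformSpace.Completion.induction_on x hc fun a => ?_
  induction a with
  | zero => exact h0
  | add a b ha hb => rw [UniformSpace.Completion.coe_add]; exact hadd _ _ ha hb
  | tmul φ k => exact ht φ k

theorem eq_zero_of_inner_htmul {x : HTensor H K} (h : ∀ φ k, ⟪htmul φ k, x⟫_ℂ = 0) : x = 0 := by
  refine ext_inner_left ℂ fun y => ?_
  rw [inner_zero_right]
  refine htensor_induction (p := fun y => ⟪y, x⟫_ℂ = 0) ?_ (inner_zero_left _) ?_ h y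
  · exact isClosed_eq (by fun_prop) continuous_const
  · intro y z hy hz
    rw [inner_add_left, hy, hz, add_zero]

theorem idTensor_one : idTensor H (1 : K →L[ℂ] K) = 1 := by
  ext x
  refine htensor_induction (p := fun x => idTensor H (1 : K →L[ℂ] K) x = x) ?_ (map_zero _)
    ?_ ?_ x
  · exact isClosed_eq (by fun_prop) continuous_id
  · intro x y hx hy
    rw [map_add, hx, hy]
  · intro φ k
    exact idTensor_coe_tmul H _ φ k

theorem inner_idTensor {A : K →L[ℂ] K} (hA : ∀ k l, ⟪A k, l⟫_ℂ = ⟪k, A l⟫_ℂ)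
    (x y : HTensor H K) : ⟪idTensor H A x, y⟫_ℂ = ⟪x, idTensor H A y⟫_ℂ := by
  refine htensor_induction (p := fun x => ⟪idTensor H A x, y⟫_ℂ = ⟪x, idTensor H A y⟫_ℂ)
    ?_ (by simp) ?_ ?_ x
  · exact isClosed_eq (by fun_prop) (by fun_prop)
  · intro a b ha hb
    rw [map_add, inner_add_left, inner_add_left, ha, hb]
  intro φ k
  refine htensor_induction (p := fun y => ⟪idTensor H A (htmul φ k), y⟫_ℂ =
    ⟪htmul φ k, idTensor H A y⟫_ℂ) ?_ (by simp) ?_ ?_ y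
  · exact isClosed_eq (by fun_prop) (by fun_prop)
  · intro a b ha hb
    rw [map_add, inner_add_right, inner_add_right, ha, hb]
  intro ψ l
  rw [idTensor_coe_tmul, idTensor_coe_tmul, inner_htmul, inner_htmul, hA]

end TensorLemmas


/-! ### Cholesky decomposition of positive kernels -/

section Cholesky

/-- The Schur complement of a positive semidefinite sesquilinear form with respect to a vector. -/
@[reducible] def schurCore {V : Type*} [AddCommGroup V] [Module ℂ V]
    (c : PreInnerProductSpace.Core ℂ V) (e : V) : PreInnerProductSpace.Core ℂ V where
  inner x y := c.inner x y - c.inner x e * c.inner e y / c.inner e e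
  conj_inner_symm x y := by
    simp only [map_sub, map_div₀, map_mul, c.conj_inner_symm]
    ring
  re_inner_nonneg x := by
    have h1 : ((c.inner e e).re : ℂ) = c.inner e e :=
      Complex.conj_eq_iff_re.1 (c.conj_inner_symm e e)
    have h2 : c.inner x e * c.inner e x = ((‖c.inner x e‖ * ‖c.inner e x‖ : ℝ) : ℂ) := by
      rw [← c.conj_inner_symm x e, RCLike.norm_conj, mul_comm, Complex.mul_conj, ← sq,
        Complex.normSq_eq_norm_sq]
    have h3 := InnerProductSpace.Core.inner_mul_inner_self_le (c := c) x e
    have h4 : 0 ≤ (c.inner e e).re := c.re_inner_nonneg e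
    have h5 : 0 ≤ (c.inner x x).re := c.re_inner_nonneg x
    rw [h2, ← h1, ← Complex.ofReal_div]
    simp only [RCLike.re_to_complex, Complex.sub_re, Complex.ofReal_re,
      sub_nonneg] at h3 ⊢
    -- Cauchy–Schwarz. A vector `e` of length zero is allowed: the quotient is then `0`.
    exact div_le_of_le_mul₀ h4 h5 h3
  add_left x y z := by
    simp only [c.add_left]
    ring
  smul_left x y r := by
    simp only [c.smul_left]
    ring

/-- A kernel on `ℕ` is positive if it is the Gram matrix of the standard basis vectors with respect
to some positive semidefinite sesquilinear form. -/
def IsPosKernel (m : ℕ → ℕ → ℂ) : Prop :=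
  ∃ c : PreInnerProductSpace.Core ℂ (ℕ →₀ ℂ),
    ∀ i j, m i j = c.inner (Finsupp.single i 1) (Finsupp.single j 1)

/-- The form is `∑ conj (x i) * y j * m i j` on finitely supported sequences; positivity at `x` is
`hp` on the support of `x`. -/
theorem isPosKernel_of_forall {m : ℕ → ℕ → ℂ} (hm : ∀ i j, starRingEnd ℂ (m j i) = m i j)
    (hp : ∀ (s : Finset ℕ) (c : ℕ → ℂ),
      0 ≤ (∑ i ∈ s, ∑ j ∈ s, starRingEnd ℂ (c i) * c j * m i j).re) : IsPosKernel m := by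
  refine ⟨
    { inner := fun x y => x.sum fun i a => y.sum fun j b => starRingEnd ℂ a * b * m i j
      conj_inner_symm := fun x y => ?_
      re_inner_nonneg := fun x => hp x.support x
      add_left := fun x y z => ?_
      smul_left := fun x y r => ?_ }, fun i j => ?_⟩
  · simp only [Finsupp.sum, map_sum, map_mul, Complex.conj_conj, hm]
    rw [Finset.sum_comm]
    exact Finset.sum_congr rfl fun _ _ => Finset.sum_congr rfl fun _ _ => by ring
  · refine Finsupp.sum_add_index' (by simp) fun i a b => ?_
    simp only [Finsupp.sum, map_add, add_mul, Finset.sum_add_distrib]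
  · rw [Finsupp.sum_smul_index' (by simp)]
    simp only [Finsupp.sum, Finset.mul_sum, smul_eq_mul, map_mul]
    exact Finset.sum_congr rfl fun _ _ => Finset.sum_congr rfl fun _ _ => by ring
  · change _ = Finsupp.sum _ _
    simp

variable {m : ℕ → ℕ → ℂ}

theorem IsPosKernel.conj_symm (hm : IsPosKernel m) (i j : ℕ) : starRingEnd ℂ (m j i) = m i j := by
  obtain ⟨c, hc⟩ := hm
  rw [hc, hc, c.conj_inner_symm]

theorem IsPosKernel.re_nonneg (hm : IsPosKernel m) (i : ℕ) : 0 ≤ (m i i).re := by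
  obtain ⟨c, hc⟩ := hm
  rw [hc]
  exact c.re_inner_nonneg _

theorem IsPosKernel.coe_re (hm : IsPosKernel m) (i : ℕ) : ((m i i).re : ℂ) = m i i :=
  Complex.conj_eq_iff_re.1 (hm.conj_symm i i)

/-- Cauchy–Schwarz. This is what makes division by a zero pivot harmless in the elimination. -/
theorem IsPosKernel.eq_zero_of_diag (hm : IsPosKernel m) {i : ℕ} (hi : m i i = 0) (j : ℕ) :
    m i j = 0 := by
  have hsymm := hm.conj_symm i j
  obtain ⟨c, hc⟩ := hm
  have h := InnerProductSpace.Core.inner_mul_inner_self_le (c := c) (Finsupp.single i 1)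
    (Finsupp.single j 1)
  rw [← hc, ← hc, ← hc, hi, map_zero, zero_mul, ← hsymm, RCLike.norm_conj] at h
  rw [← hsymm, norm_eq_zero.1 (mul_self_eq_zero.1 (le_antisymm h (mul_self_nonneg _))), map_zero]

/-- The iterated Schur complements of a kernel with respect to `0, 1, 2, …`. -/
def schurKernel (m : ℕ → ℕ → ℂ) : ℕ → ℕ → ℕ → ℂ
  | 0 => m
  | n + 1 => fun i j => schurKernel m n i j -
      schurKernel m n i n * schurKernel m n n j / schurKernel m n n n

/-- The rows of the Cholesky factor of a positive kernel. -/
def cholesky (m : ℕ → ℕ → ℂ) (n j : ℕ) : ℂ :=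
  schurKernel m n n j / (√(schurKernel m n n n).re : ℝ)

theorem IsPosKernel.schurKernel (hm : IsPosKernel m) (n : ℕ) : IsPosKernel (schurKernel m n) := by
  induction n with
  | zero => exact hm
  | succ n ih =>
    obtain ⟨c, hc⟩ := ih
    exact ⟨schurCore c (Finsupp.single n 1), fun i j => by simp only [QMeas.schurKernel, hc]; rfl⟩

/-- Step `i` of the elimination clears row `i`, and later steps keep it zero. If the pivot is zero,
the row was already zero by positivity. -/
theorem IsPosKernel.schurKernel_eq_zero (hm : IsPosKernel m) {n i : ℕ} (hi : i < n) (j : ℕ) :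
    QMeas.schurKernel m n i j = 0 := by
  induction n generalizing j with
  | zero => omega
  | succ n ih =>
    rw [QMeas.schurKernel]
    rcases Nat.lt_succ_iff_lt_or_eq.1 hi with h | rfl
    · simp [ih h]
    · by_cases h0 : QMeas.schurKernel m i i i = 0
      · simp [(hm.schurKernel i).eq_zero_of_diag h0]
      · field_simp
        ring

theorem schurKernel_eq_zero_of_row {i : ℕ} (hi : ∀ j, m i j = 0) (n j : ℕ) :
    schurKernel m n i j = 0 := by
  induction n generalizing j with
  | zero => exact hi j
  | succ n ih => simp [schurKernel, ih]

theorem cholesky_eq_zero_of_row {i : ℕ} (hi : ∀ j, m i j = 0) (j : ℕ) : cholesky m i j = 0 := by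
  simp [cholesky, schurKernel_eq_zero_of_row hi]

theorem IsPosKernel.cholesky_eq_zero (hm : IsPosKernel m) {n j : ℕ} (hj : j < n) :
    cholesky m n j = 0 := by
  rw [cholesky, ← (hm.schurKernel n).conj_symm, hm.schurKernel_eq_zero hj, map_zero, zero_div]

theorem IsPosKernel.conj_cholesky_mul (hm : IsPosKernel m) (n i j : ℕ) :
    starRingEnd ℂ (cholesky m n i) * cholesky m n j =
      QMeas.schurKernel m n i n * QMeas.schurKernel m n n j / QMeas.schurKernel m n n n := by
  have hn := hm.schurKernel n
  rw [cholesky, cholesky, map_div₀, hn.conj_symm, Complex.conj_ofReal, div_mul_div_comm,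
    ← Complex.ofReal_mul, Real.mul_self_sqrt (hn.re_nonneg n), hn.coe_re]

/-- Each summand is the rank one term removed at that step, so the sum telescopes. -/
theorem IsPosKernel.sum_cholesky (hm : IsPosKernel m) (N i j : ℕ) :
    ∑ n ∈ Finset.range N, starRingEnd ℂ (cholesky m n i) * cholesky m n j =
      m i j - QMeas.schurKernel m N i j := by
  induction N with
  | zero => simp [QMeas.schurKernel]
  | succ N ih =>
    rw [Finset.sum_range_succ, ih, hm.conj_cholesky_mul]
    simp only [QMeas.schurKernel]
    ring

theorem IsPosKernel.sum_cholesky_eq (hm : IsPosKernel m) {N i : ℕ} (hi : i < N) (j : ℕ) :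
    ∑ n ∈ Finset.range N, starRingEnd ℂ (cholesky m n i) * cholesky m n j = m i j := by
  rw [hm.sum_cholesky, hm.schurKernel_eq_zero hi, sub_zero]

/-- On the diagonal, the partial sum of squares and the nonnegative remainder add up to `m j j`. -/
theorem IsPosKernel.norm_cholesky_sq_le (hm : IsPosKernel m) (n j : ℕ) :
    ‖cholesky m n j‖ ^ 2 ≤ (m j j).re := by
  have h := congrArg Complex.re (hm.sum_cholesky (n + 1) j j)
  have hre : ∀ k, (starRingEnd ℂ (cholesky m k j) * cholesky m k j).re = ‖cholesky m k j‖ ^ 2 := by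
    intro k
    rw [mul_comm, Complex.mul_conj, Complex.ofReal_re, Complex.normSq_eq_norm_sq]
  simp only [Complex.re_sum, hre, Complex.sub_re] at h
  have h1 := (hm.schurKernel (n + 1)).re_nonneg j
  have h2 := Finset.single_le_sum (f := fun k => ‖cholesky m k j‖ ^ 2)
    (fun k _ => sq_nonneg _) (Finset.self_mem_range_succ n)
  linarith

end Cholesky

/-! ### Square integrable Cholesky factors of an observable -/

section Density

variable {Ω : Type w} [MeasurableSpace Ω]
  {H : Type u} [NormedAddCommGroup H] [InnerProductSpace ℂ H]
  {M : Set Ω → H →L[ℂ] H}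

/-- Positivity of `M X` gives positivity of the density form at each fixed coefficient vector,
outside a null set depending on that vector. A dense sequence of vectors and continuity yield one
null set for all of them. -/
theorem IsObservable.exists_posKernel_density (hM : IsObservable M) (μ : Measure Ω)
    [IsProbabilityMeasure μ] (hμ : ∀ X, MeasurableSet X → μ X = 0 → M X = 0) (v : ℕ → H) :
    ∃ m : Ω → ℕ → ℕ → ℂ, (∀ i j, Measurable fun x => m x i j) ∧
      (∀ i j, Integrable (fun x => m x i j) μ) ∧
      (∀ i j X, MeasurableSet X → ∫ x in X, m x i j ∂μ = ⟪v i, M X (v j)⟫_ℂ) ∧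
      ∀ᵐ x ∂μ, IsPosKernel (m x) := by
  have hd : ∀ i j, ∃ d : Ω → ℂ, Measurable d ∧ Integrable d μ ∧
      ∀ X, MeasurableSet X → ∫ x in X, d x ∂μ = ⟪v i, M X (v j)⟫_ℂ := fun i j =>
    hM.exists_density μ (v i) (v j) fun X hX h0 => by simp [hμ X hX h0]
  choose d hdm hdi hdX using hd
  refine ⟨fun x i j => d i j x, hdm, hdi, hdX, ?_⟩
  have hsymm : ∀ᵐ x ∂μ, ∀ i j, starRingEnd ℂ (d j i x) = d i j x := by
    rw [ae_all_iff]
    intro i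
    rw [ae_all_iff]
    intro j
    refine Integrable.ae_eq_of_forall_setIntegral_eq (fun x => starRingEnd ℂ (d j i x)) (d i j)
      ((Complex.conjLIE : ℂ →L[ℝ] ℂ).integrable_comp (hdi j i)) (hdi i j) fun X hX _ => ?_
    rw [integral_conj, hdX j i X hX, hdX i j X hX, inner_conj_symm]
    exact (hM.isPositive X hX).isSymmetric _ _
  have hpos1 : ∀ (s : Finset ℕ) (c : ℕ → ℂ),
      ∀ᵐ x ∂μ, 0 ≤ (∑ i ∈ s, ∑ j ∈ s, starRingEnd ℂ (c i) * c j * d i j x).re := by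
    intro s c
    have hint : Integrable (fun x => ∑ i ∈ s, ∑ j ∈ s, starRingEnd ℂ (c i) * c j * d i j x) μ :=
      integrable_finsetSum _ fun i _ => integrable_finsetSum _ fun j _ => (hdi i j).const_mul _
    refine ae_nonneg_of_forall_setIntegral_nonneg
      (f := fun x => (∑ i ∈ s, ∑ j ∈ s, starRingEnd ℂ (c i) * c j * d i j x).re)
      hint.re fun X hX _ => ?_
    have h1 : ∫ x in X, (∑ i ∈ s, ∑ j ∈ s, starRingEnd ℂ (c i) * c j * d i j x) ∂μ =
        ⟪∑ i ∈ s, c i • v i, M X (∑ i ∈ s, c i • v i)⟫_ℂ := by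
      rw [integral_finsetSum _ fun i _ =>
        integrable_finsetSum _ fun j _ => ((hdi i j).const_mul _).restrict, sum_inner]
      refine Finset.sum_congr rfl fun i _ => ?_
      rw [integral_finsetSum _ fun j _ => ((hdi i j).const_mul _).restrict, map_sum, inner_sum]
      refine Finset.sum_congr rfl fun j _ => ?_
      rw [integral_const_mul, hdX i j X hX, map_smul, inner_smul_left, inner_smul_right, mul_assoc]
    have h2 := integral_re (hint.restrict (s := X))
    rw [h1] at h2
    exact h2.symm ▸ (hM.isPositive X hX).re_inner_nonneg_right _
  have hpos2 : ∀ᵐ x ∂μ, ∀ (s : Finset ℕ) (n : ℕ), 0 ≤ (∑ i ∈ s, ∑ j ∈ s,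
      starRingEnd ℂ (TopologicalSpace.denseSeq (ℕ → ℂ) n i) *
        TopologicalSpace.denseSeq (ℕ → ℂ) n j * d i j x).re := by
    rw [ae_all_iff]
    intro s
    rw [ae_all_iff]
    exact fun n => hpos1 s _
  filter_upwards [hsymm, hpos2] with x hx hx'
  refine isPosKernel_of_forall hx fun s c => ?_
  have hcl : IsClosed {c : ℕ → ℂ |
      0 ≤ (∑ i ∈ s, ∑ j ∈ s, starRingEnd ℂ (c i) * c j * d i j x).re} := by
    refine isClosed_le continuous_const (Complex.continuous_re.comp ?_)
    refine continuous_finsetSum _ fun i _ => continuous_finsetSum _ fun j _ => ?_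
    exact ((Complex.continuous_conj.comp (continuous_apply i)).mul (continuous_apply j)).mul
      continuous_const
  have hsub : Set.range (TopologicalSpace.denseSeq (ℕ → ℂ)) ⊆ {c : ℕ → ℂ |
      0 ≤ (∑ i ∈ s, ∑ j ∈ s, starRingEnd ℂ (c i) * c j * d i j x).re} := by
    rintro _ ⟨n, rfl⟩
    exact hx' s n
  have hall := hcl.closure_subset_iff.2 hsub
  rw [(TopologicalSpace.denseRange_denseSeq (ℕ → ℂ)).closure_range] at hall
  exact hall (Set.mem_univ c)

theorem measurable_schurKernel {m : Ω → ℕ → ℕ → ℂ} (hm : ∀ i j, Measurable fun x => m x i j)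
    (n i j : ℕ) : Measurable fun x => schurKernel (m x) n i j := by
  induction n generalizing i j with
  | zero => exact hm i j
  | succ n ih => exact (ih i j).sub (((ih i n).mul (ih n j)).div (ih n n))

theorem measurable_cholesky {m : Ω → ℕ → ℕ → ℂ} (hm : ∀ i j, Measurable fun x => m x i j)
    (n j : ℕ) : Measurable fun x => cholesky (m x) n j :=
  (measurable_schurKernel hm n n j).div
    (Complex.measurable_ofReal.comp (Complex.measurable_re.comp
      (measurable_schurKernel hm n n n)).sqrt)

theorem IsObservable.exists_cholesky (hM : IsObservable M) (μ : Measure Ω)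
    [IsProbabilityMeasure μ] (hμ : ∀ X, MeasurableSet X → μ X = 0 → M X = 0) (v : ℕ → H) :
    ∃ R : ℕ → ℕ → Lp ℂ 2 μ, (∀ n j, j < n → R n j = 0) ∧ (∀ n, v n = 0 → ∀ j, R n j = 0) ∧
      ∀ N i j, i < N → ∀ X, MeasurableSet X →
        ∑ n ∈ Finset.range N, ⟪R n i, canonicalPVM μ X (R n j)⟫_ℂ = ⟪v i, M X (v j)⟫_ℂ := by
  obtain ⟨m, hmm, hmi, hmX, hpos⟩ := hM.exists_posKernel_density μ hμ v
  have hL2 : ∀ n j, MemLp (fun x => cholesky (m x) n j) 2 μ := by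
    intro n j
    have hmeas := (measurable_cholesky hmm n j).aestronglyMeasurable (μ := μ)
    rw [memLp_two_iff_integrable_sq_norm hmeas]
    refine (hmi j j).re.mono (hmeas.norm.pow 2) ?_
    filter_upwards [hpos] with x hx
    rw [Real.norm_of_nonneg (sq_nonneg _)]
    exact (hx.norm_cholesky_sq_le n j).trans (Real.le_norm_self _)
  have hzero : ∀ n j, (∀ᵐ x ∂μ, cholesky (m x) n j = 0) → (hL2 n j).toLp _ = 0 := by
    intro n j h
    refine Lp.ext ?_
    filter_upwards [h, (hL2 n j).coeFn_toLp, Lp.coeFn_zero ℂ 2 μ] with x h1 h2 h3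
    rw [h2, h1, h3, Pi.zero_apply]
  refine ⟨fun n j => (hL2 n j).toLp _, fun n j hj => hzero n j ?_, fun n hn j => hzero n j ?_, ?_⟩
  · filter_upwards [hpos] with x hx using hx.cholesky_eq_zero hj
  · have hrow : ∀ᵐ x ∂μ, ∀ j, m x n j = 0 := by
      rw [ae_all_iff]
      intro j
      refine Integrable.ae_eq_of_forall_setIntegral_eq _ _ (hmi n j) (integrable_zero _ _ _)
        fun X hX _ => ?_
      rw [hmX n j X hX, hn, inner_zero_left, integral_zero]
    filter_upwards [hrow] with x hx using cholesky_eq_zero_of_row hx j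
  · intro N i j hi X hX
    have hint : ∀ n ∈ Finset.range N, Integrable
        (fun x => starRingEnd ℂ (cholesky (m x) n i) * cholesky (m x) n j) (μ.restrict X) :=
      fun n _ => ((hL2 n i).star.integrable_mul (hL2 n j)).restrict
    have h1 : ∀ n, ⟪(hL2 n i).toLp _, canonicalPVM μ X ((hL2 n j).toLp _)⟫_ℂ =
        ∫ x in X, starRingEnd ℂ (cholesky (m x) n i) * cholesky (m x) n j ∂μ := by
      intro n
      rw [inner_canonicalPVM μ hX]
      refine integral_congr_ae (ae_restrict_of_ae ?_)
      filter_upwards [(hL2 n i).coeFn_toLp, (hL2 n j).coeFn_toLp] with x hi hj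
      rw [hi, hj, RCLike.inner_apply, mul_comm]
    simp only [h1]
    rw [← integral_finsetSum _ hint, ← hmX i j X hX]
    refine integral_congr_ae (ae_restrict_of_ae ?_)
    filter_upwards [hpos] with x hx using hx.sum_cholesky_eq hi j

end Density

/-! ### Unitary operators between orthonormal families -/

section Unitary

variable {E : Type u} [NormedAddCommGroup E] [InnerProductSpace ℂ E]

theorem _root_.HilbertBasis.exists_reindex [CompleteSpace E] {ι : Type v} {ι' : Type w}
    (b : HilbertBasis ι ℂ E) (e : ι' ≃ ι) : ∃ b' : HilbertBasis ι' ℂ E, ∀ i, b' i = b (e i) :=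
  ⟨HilbertBasis.mk (b.orthonormal.comp e e.injective)
    (by rw [EquivLike.range_comp, b.dense_span]), fun i => by rw [HilbertBasis.coe_mk]; rfl⟩

variable [CompleteSpace E] {κ : Type v}

theorem exists_hilbertBasis_sum {s : κ → E} (hs : Orthonormal ℂ s) :
    ∃ (ι : Type u) (b : HilbertBasis (κ ⊕ ι) ℂ E), ∀ i, b (Sum.inl i) = s i := by
  classical
  obtain ⟨w, b, hsw, hb⟩ := hs.toSubtypeRange.exists_hilbertBasis_extension
  have hinj : Function.Injective s := hs.linearIndependent.injective
  let e : κ ⊕ ↥(w \ Set.range s) ≃ w :=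
    ((Equiv.ofInjective s hinj).sumCongr (Equiv.refl _)).trans (Equiv.Set.sumDiffSubset hsw)
  obtain ⟨b', hb'⟩ := b.exists_reindex e
  exact ⟨_, b', fun i => by simp [hb', hb, e]⟩

theorem exists_unitary_of_equiv {ι ι' : Type*} (b : HilbertBasis (κ ⊕ ι) ℂ E)
    (b' : HilbertBasis (κ ⊕ ι') ℂ E) (f : ι ≃ ι') :
    ∃ U ∈ unitary (E →L[ℂ] E), ∀ i, U (b (Sum.inl i)) = b' (Sum.inl i) := by
  classical
  obtain ⟨b'', hb''⟩ := b'.exists_reindex ((Equiv.refl κ).sumCongr f)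
  let T : E ≃ₗᵢ[ℂ] E := b.repr.trans b''.repr.symm
  refine ⟨Unitary.linearIsometryEquiv.symm T, (Unitary.linearIsometryEquiv.symm T).2,
    fun i => ?_⟩
  change b''.repr.symm (b.repr (b (Sum.inl i))) = _
  rw [b.repr_self, b''.repr_symm_single, hb'']
  rfl

/-- Two finite orthonormal families indexed by the same type are related by a unitary operator. -/
theorem exists_unitary_of_finite [Finite κ] {s t : κ → E} (hs : Orthonormal ℂ s)
    (ht : Orthonormal ℂ t) : ∃ U ∈ unitary (E →L[ℂ] E), ∀ i, U (s i) = t i := by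
  obtain ⟨ι, b, hb⟩ := exists_hilbertBasis_sum hs
  obtain ⟨ι', b', hb'⟩ := exists_hilbertBasis_sum ht
  have h := (lift_mk_eq_lift_hilbertDim b).trans (lift_mk_eq_lift_hilbertDim b').symm
  rw [Cardinal.lift_inj, Cardinal.mk_sum, Cardinal.mk_sum] at h
  -- Both bases have the dimension of `E` as cardinality; the finite part `κ` cancels.
  have h2 := Cardinal.lift_inj.1 (Cardinal.eq_of_add_eq_add_left h (by simp))
  obtain ⟨f⟩ := Cardinal.eq.1 h2
  simpa only [hb, hb'] using exists_unitary_of_equiv b b' f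

/-- Two infinite orthonormal families, each of which is orthogonal to a further orthonormal family
of the same cardinality, are related by a unitary operator. -/
theorem exists_unitary_of_infinite [Infinite κ] {s s' t t' : κ → E}
    (hs : Orthonormal ℂ (Sum.elim s s')) (ht : Orthonormal ℂ (Sum.elim t t')) :
    ∃ U ∈ unitary (E →L[ℂ] E), ∀ i, U (s i) = t i := by
  obtain ⟨ι, b, hb⟩ := exists_hilbertBasis_sum hs
  obtain ⟨ι', b', hb'⟩ := exists_hilbertBasis_sum ht
  have h := (lift_mk_eq_lift_hilbertDim b).trans (lift_mk_eq_lift_hilbertDim b').symm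
  obtain ⟨e⟩ := Cardinal.eq.1 (Cardinal.lift_inj.1 h)
  have hκ : Cardinal.mk (κ ⊕ κ) = Cardinal.mk κ := by
    rw [Cardinal.mk_sum, Cardinal.lift_id, Cardinal.add_eq_self (Cardinal.aleph0_le_mk κ)]
  obtain ⟨g⟩ := Cardinal.eq.1 hκ
  obtain ⟨c, hc⟩ := b.exists_reindex (Equiv.sumAssoc κ κ ι).symm
  obtain ⟨c', hc'⟩ := b'.exists_reindex (Equiv.sumAssoc κ κ ι').symm
  -- The complement of `s` is indexed by `κ ⊕ ι`; since `κ ≃ κ ⊕ κ`, it is as large as a full basis,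
  -- and likewise for `t`.
  let f : κ ⊕ ι ≃ κ ⊕ ι' :=
    (g.symm.sumCongr (Equiv.refl ι)).trans (e.trans (g.sumCongr (Equiv.refl ι')))
  simpa [hc, hc', hb, hb'] using exists_unitary_of_equiv c c' f

end Unitary

/-! ### Existence of a normal measurement on `L²(μ)` -/

section Existence

variable {Ω : Type w} [MeasurableSpace Ω]
  {H : Type u} [NormedAddCommGroup H] [InnerProductSpace ℂ H]

theorem countable_of_orthonormal {E : Type*} [NormedAddCommGroup E] [InnerProductSpace ℂ E]
    [TopologicalSpace.SeparableSpace E] {ι : Type*} {b : ι → E} (hb : Orthonormal ℂ b) :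
    Countable ι := by
  refine Pairwise.countable_of_isOpen_disjoint (s := fun i => Metric.ball (b i) (1 / 2)) ?_
    (fun _ => Metric.isOpen_ball) (fun i => ⟨b i, Metric.mem_ball_self (by norm_num)⟩)
  -- Distinct members are at distance `√2`, so balls of radius `1 / 2` are disjoint.
  intro i j hij
  refine Metric.ball_disjoint_ball ?_
  have h : ‖b i - b j‖ ^ 2 = 2 := by
    rw [@norm_sub_sq ℂ, hb.1, hb.1, hb.2 hij]
    norm_num
  rw [dist_eq_norm]
  nlinarith [norm_nonneg (b i - b j)]

theorem _root_.HilbertBasis.clm_ext {ι : Type*} (b : HilbertBasis ι ℂ H) {A B : H →L[ℂ] H}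
    (h : ∀ i j, ⟪b i, A (b j)⟫_ℂ = ⟪b i, B (b j)⟫_ℂ) : A = B := by
  have hd : Dense (Submodule.span ℂ (Set.range b) : Set H) := by
    rw [Submodule.dense_iff_topologicalClosure_eq_top, b.dense_span]
  refine ContinuousLinearMap.ext_on hd ?_
  rintro _ ⟨j, rfl⟩
  apply b.repr.injective
  ext i
  rw [b.repr_apply_apply, b.repr_apply_apply, h]

/-- The Cholesky factors of an observable combine to vectors in `H ⊗ L²(μ)` whose Gram matrices
are the matrices of the observable. -/
theorem IsObservable.exists_htensor_gram {M : Set Ω → H →L[ℂ] H} (hM : IsObservable M)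
    (μ : Measure Ω) [IsProbabilityMeasure μ] (hμ : ∀ X, MeasurableSet X → μ X = 0 → M X = 0)
    {κ : Type*} [Countable κ] (b : κ → H) {c : κ → H} (hc : Orthonormal ℂ c) :
    ∃ t : κ → HTensor H (Lp ℂ 2 μ),
      (∀ i j X, MeasurableSet X →
        ⟪t i, idTensor H (canonicalPVM μ X) (t j)⟫_ℂ = ⟪b i, M X (b j)⟫_ℂ) ∧
      ∀ φ f, (∀ i, ⟪c i, φ⟫_ℂ = 0) → ∀ i, ⟪t i, htmul φ f⟫_ℂ = 0 := by
  have := Encodable.ofCountable κ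
  set e : κ → ℕ := Encodable.encode
  have he : Function.Injective e := Encodable.encode_injective
  -- The index set is embedded in `ℕ`, with zero vectors at the unused indices.
  let v : ℕ → H := Function.extend e b 0
  let d : ℕ → H := Function.extend e c 0
  have hv : ∀ i, v (e i) = b i := fun i => he.extend_apply _ _ _
  have hd : ∀ i, d (e i) = c i := fun i => he.extend_apply _ _ _
  have hv0 : ∀ n, (¬ ∃ i, e i = n) → v n = 0 := fun n hn => Function.extend_apply' _ _ _ hn
  have hd0 : ∀ n, (¬ ∃ i, e i = n) → d n = 0 := fun n hn => Function.extend_apply' _ _ _ hn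
  obtain ⟨R, hR, hR0, hRX⟩ := hM.exists_cholesky μ hμ v
  let t : κ → HTensor H (Lp ℂ 2 μ) := fun j =>
    ∑ n ∈ Finset.range (e j + 1), htmul (d n) (R n (e j))
  -- By triangularity the sum may be cut off at any larger index, so two vectors can share one
  -- range.
  have ht : ∀ j N, e j < N → t j = ∑ n ∈ Finset.range N, htmul (d n) (R n (e j)) := by
    intro j N hN
    refine Finset.sum_subset (Finset.range_subset_range.2 hN) fun n _ hn => ?_
    rw [Finset.mem_range, not_lt] at hn
    rw [hR n (e j) hn, htmul, TensorProduct.tmul_zero, UniformSpace.Completion.coe_zero]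
  have hdd : ∀ n m f g, m ≠ n → ⟪d n, d m⟫_ℂ * ⟪R n f, g⟫_ℂ = 0 := by
    intro n m f g hnm
    by_cases hn : ∃ i, e i = n
    · by_cases hm : ∃ i, e i = m
      · obtain ⟨i, rfl⟩ := hn
        obtain ⟨j, rfl⟩ := hm
        rw [hd, hd, hc.2 fun h => hnm (by rw [h]), zero_mul]
      · rw [hd0 m hm, inner_zero_right, zero_mul]
    · rw [hd0 n hn, inner_zero_left, zero_mul]
  -- At an unused index `d n = 0` is not a unit vector, but the Cholesky row `R n` vanishes there as
  -- well.
  have hd1 : ∀ n f g, ⟪d n, d n⟫_ℂ * ⟪R n f, g⟫_ℂ = ⟪R n f, g⟫_ℂ := by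
    intro n f g
    by_cases hn : ∃ i, e i = n
    · obtain ⟨i, rfl⟩ := hn
      rw [hd, inner_self_eq_norm_sq_to_K, hc.1]
      simp
    · rw [hR0 n (hv0 n hn), inner_zero_left, mul_zero]
  refine ⟨t, fun i j X hX => ?_, fun φ f hφ i => ?_⟩
  · have hi : e i < max (e i) (e j) + 1 := by omega
    have hj : e j < max (e i) (e j) + 1 := by omega
    rw [ht i _ hi, ht j _ hj, map_sum, sum_inner, ← hv i, ← hv j, ← hRX _ _ _ hi X hX]
    refine Finset.sum_congr rfl fun n hn => ?_
    rw [inner_sum, Finset.sum_eq_single_of_mem n hn]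
    · rw [idTensor_coe_tmul, inner_htmul, hd1]
    · intro m _ hm
      rw [idTensor_coe_tmul, inner_htmul, hdd _ _ _ _ hm]
  · rw [sum_inner]
    refine Finset.sum_eq_zero fun n _ => ?_
    rw [inner_htmul]
    by_cases hn : ∃ i, e i = n
    · obtain ⟨i, rfl⟩ := hn
      rw [hd, hφ, zero_mul]
    · rw [hd0 n hn, inner_zero_left, zero_mul]

theorem orthonormal_htmul {K : Type*} [NormedAddCommGroup K] [InnerProductSpace ℂ K]
    {κ : Type*} {b : κ → H} (hb : Orthonormal ℂ b) {k : K} (hk : ‖k‖ = 1) :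
    Orthonormal ℂ fun i => htmul (b i) k := by
  refine ⟨fun i => by rw [norm_htmul, hb.1, hk, one_mul], fun i j hij => ?_⟩
  change ⟪htmul (b i) k, htmul (b j) k⟫_ℂ = 0
  rw [inner_htmul, hb.2 hij, zero_mul]

theorem orthonormal_sumElim {E : Type*} [NormedAddCommGroup E] [InnerProductSpace ℂ E]
    {ι κ : Type*} {s : ι → E} {t : κ → E} (hs : Orthonormal ℂ s) (ht : Orthonormal ℂ t)
    (hst : ∀ i j, ⟪s i, t j⟫_ℂ = 0) : Orthonormal ℂ (Sum.elim s t) := by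
  refine ⟨?_, ?_⟩
  · rintro (i | i)
    exacts [hs.1 i, ht.1 i]
  · rintro (i | i) (j | j) hij
    · exact hs.2 fun h => hij (by rw [h])
    · exact hst i j
    · exact inner_eq_zero_symm.1 (hst j i)
    · exact ht.2 fun h => hij (by rw [h])

variable [CompleteSpace H]

theorem isNormalMeasurement_of_basis {M : Set Ω → H →L[ℂ] H} {μ : Measure Ω} {κ : Type*}
    (b : HilbertBasis κ ℂ H) {ξ : Lp ℂ 2 μ} (hξ : ‖ξ‖ = 1)
    {U : HTensor H (Lp ℂ 2 μ) →L[ℂ] HTensor H (Lp ℂ 2 μ)} (hU : U ∈ unitary _)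
    (h : ∀ i j X, MeasurableSet X → ⟪U (htmul (b i) ξ),
      idTensor H (canonicalPVM μ X) (U (htmul (b j) ξ))⟫_ℂ = ⟪b i, M X (b j)⟫_ℂ) :
    IsNormalMeasurement M (canonicalPVM μ) U ξ := by
  refine ⟨canonicalPVM_isSharpObservable μ, hU, hξ, fun X hX => b.clm_ext fun i j => ?_⟩
  rw [← h i j X hX]
  simp only [ContinuousLinearMap.comp_apply, ContinuousLinearMap.adjoint_inner_right,
    tensorVec_apply]

theorem IsObservable.exists_isNormalMeasurement [TopologicalSpace.SeparableSpace H]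
    {M : Set Ω → H →L[ℂ] H} (hM : IsObservable M) (μ : Measure Ω) [IsProbabilityMeasure μ]
    (hμ : ∀ X, MeasurableSet X → μ X = 0 → M X = 0) :
    ∃ (U : HTensor H (Lp ℂ 2 μ) →L[ℂ] HTensor H (Lp ℂ 2 μ)) (ξ : Lp ℂ 2 μ),
      IsNormalMeasurement M (canonicalPVM μ) U ξ := by
  obtain ⟨κ, b, -⟩ := exists_hilbertBasis ℂ H
  have : Countable κ := countable_of_orthonormal b.orthonormal
  let ξ : Lp ℂ 2 μ := Lp.const 2 μ 1
  have hξ : ‖ξ‖ = 1 := by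
    rw [Lp.norm_const' _ _ _ (by norm_num) (by norm_num)]
    simp
  -- Orthonormality is the case `X = Ω` of the Gram identity.
  have hgram : ∀ {t : κ → HTensor H (Lp ℂ 2 μ)}, (∀ i j X, MeasurableSet X →
      ⟪t i, idTensor H (canonicalPVM μ X) (t j)⟫_ℂ = ⟪b i, M X (b j)⟫_ℂ) → Orthonormal ℂ t := by
    intro t ht
    classical
    rw [orthonormal_iff_ite]
    intro i j
    have h := ht i j Set.univ MeasurableSet.univ
    rw [(canonicalPVM_isSharpObservable μ).univ, idTensor_one, hM.univ] at h
    exact h.trans (orthonormal_iff_ite.1 b.orthonormal i j)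
  rcases finite_or_infinite κ with hκ | hκ
  · obtain ⟨t, ht, -⟩ := hM.exists_htensor_gram μ hμ b b.orthonormal
    obtain ⟨U, hU, hUt⟩ := exists_unitary_of_finite (orthonormal_htmul b.orthonormal hξ) (hgram ht)
    exact ⟨U, ξ, isNormalMeasurement_of_basis b hξ hU fun i j X hX => by
      rw [hUt, hUt, ht i j X hX]⟩
  -- If `μ` takes only the values `0` and `1`, there may be no `η` orthogonal to `ξ`. But then `M X`
  -- and `χ_X` are both `0` or both `1`, so `U = 1` works.
  by_cases htriv : ∀ X, MeasurableSet X → μ X = 0 ∨ μ Xᶜ = 0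
  · refine ⟨1, ξ, isNormalMeasurement_of_basis b hξ (one_mem _) fun i j X hX => ?_⟩
    change ⟪htmul (b i) ξ, idTensor H (canonicalPVM μ X) (htmul (b j) ξ)⟫_ℂ = _
    rw [idTensor_coe_tmul, inner_htmul]
    have hP : ∀ {Y}, MeasurableSet Y → μ Y = 0 → canonicalPVM μ Y = 0 := by
      intro Y hY h0
      ext1 f
      refine Lp.ext ?_
      filter_upwards [canonicalPVM_coeFn μ hY f, Lp.coeFn_zero ℂ 2 μ,
        measure_eq_zero_iff_ae_notMem.1 h0] with x h1 h2 h3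
      rw [h1, Set.indicator_of_notMem h3]
      exact h2.symm
    rcases htriv X hX with h0 | h0
    · rw [hP hX h0, hμ X hX h0]
      simp
    · have h1 := (canonicalPVM_isSharpObservable μ).compl hX
      have h2 := hM.compl hX
      rw [hP hX.compl h0, add_zero] at h1
      rw [hμ _ hX.compl h0, add_zero] at h2
      rw [h1, h2]
      simp [inner_self_eq_norm_sq_to_K, hξ]
  · push Not at htriv
    obtain ⟨X, hX, hX0, hX1⟩ := htriv
    -- The part of `χ_X` orthogonal to the constants; it is nonzero because neither `X` nor its
    -- complement is null.
    let ζ : Lp ℂ 2 μ := canonicalPVM μ X ξ - ⟪ξ, canonicalPVM μ X ξ⟫_ℂ • ξ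
    have hζξ : ⟪ξ, ζ⟫_ℂ = 0 := by
      rw [inner_sub_right, inner_smul_right, inner_self_eq_norm_sq_to_K, hξ]
      simp
    have hζ0 : ζ ≠ 0 := by
      intro h0
      have hξ1 := Lp.coeFn_const (p := 2) (μ := μ) (1 : ℂ)
      have hae : ∀ᵐ x ∂μ, X.indicator (fun _ => (1 : ℂ)) x = ⟪ξ, canonicalPVM μ X ξ⟫_ℂ := by
        have h1 := sub_eq_zero.1 h0
        have h2 := Lp.coeFn_smul (⟪ξ, canonicalPVM μ X ξ⟫_ℂ) ξ
        rw [← h1] at h2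
        filter_upwards [h2, canonicalPVM_coeFn μ hX ξ, hξ1] with x h3 h4 h5
        rw [h4, Pi.smul_apply] at h3
        by_cases hx : x ∈ X <;> simpa [hx, ξ, h5] using h3
      by_cases hc : ⟪ξ, canonicalPVM μ X ξ⟫_ℂ = 0
      · refine hX0 (measure_eq_zero_iff_ae_notMem.2 ?_)
        filter_upwards [hae] with x hx hxX
        rw [hc] at hx
        simp [hxX] at hx
      · refine hX1 (measure_eq_zero_iff_ae_notMem.2 ?_)
        filter_upwards [hae] with x hx hxX
        rw [Set.indicator_of_notMem hxX] at hx
        exact hc hx.symm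
    let η : Lp ℂ 2 μ := ((‖ζ‖⁻¹ : ℝ) : ℂ) • ζ
    have hη : ‖η‖ = 1 := by
      rw [norm_smul, Complex.norm_real, norm_inv, norm_norm,
        inv_mul_cancel₀ (norm_ne_zero_iff.2 hζ0)]
    have hηξ : ⟪ξ, η⟫_ℂ = 0 := by rw [inner_smul_right, hζξ, mul_zero]
    have hκκ : Cardinal.mk (κ ⊕ κ) = Cardinal.mk κ := by
      rw [Cardinal.mk_sum, Cardinal.lift_id, Cardinal.add_eq_self (Cardinal.aleph0_le_mk κ)]
    -- The basis splits into two halves. The vectors `t` use the left half, so the right half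
    -- tensored with `ξ` is orthogonal to them; on the source side `b i ⊗ η` supplies the spare
    -- family.
    obtain ⟨g⟩ := Cardinal.eq.1 hκκ
    have hbg := b.orthonormal.comp g g.injective
    have hl : Orthonormal ℂ fun i => b (g (Sum.inl i)) := hbg.comp _ Sum.inl_injective
    have hr : Orthonormal ℂ fun i => b (g (Sum.inr i)) := hbg.comp _ Sum.inr_injective
    obtain ⟨t, ht, ht'⟩ := hM.exists_htensor_gram μ hμ b hl
    have h1 := orthonormal_sumElim (orthonormal_htmul b.orthonormal hξ)
      (orthonormal_htmul b.orthonormal hη) fun i j => by rw [inner_htmul, hηξ, mul_zero]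
    have h2 := orthonormal_sumElim (hgram ht) (orthonormal_htmul hr hξ) fun i j =>
      ht' _ _ (fun k => hbg.2 Sum.inl_ne_inr) i
    obtain ⟨U, hU, hUt⟩ := exists_unitary_of_infinite h1 h2
    exact ⟨U, ξ, isNormalMeasurement_of_basis b hξ hU fun i j X hX => by
      rw [hUt, hUt, ht i j X hX]⟩

end Existence

/-! ### The dimension of the apparatus -/

section Dimension

/-- Equal Gram matrices give corresponding linear combinations equal norms, so `u i ↦ u' i` is well
defined and isometric on a dense subspace. -/
theorem exists_linearIsometry_of_gram {ι : Type*} {E F : Type*} [NormedAddCommGroup E]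
    [InnerProductSpace ℂ E] [NormedAddCommGroup F] [InnerProductSpace ℂ F] [CompleteSpace F]
    {u : ι → E} {u' : ι → F} (h : ∀ i j, ⟪u i, u j⟫_ℂ = ⟪u' i, u' j⟫_ℂ)
    (hu : Dense (Submodule.span ℂ (Set.range u) : Set E)) : Nonempty (E →ₗᵢ[ℂ] F) := by
  let e := Finsupp.linearCombination ℂ u
  let f := Finsupp.linearCombination ℂ u'
  have hnorm : ∀ x, ‖f x‖ = ‖e x‖ := by
    intro x
    have h1 : ⟪f x, f x⟫_ℂ = ⟪e x, e x⟫_ℂ := by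
      simp only [e, f, Finsupp.linearCombination_apply, Finsupp.sum_inner, Finsupp.inner_sum,
        inner_smul_left, inner_smul_right, h]
    rw [inner_self_eq_norm_sq_to_K, inner_self_eq_norm_sq_to_K] at h1
    exact (sq_eq_sq₀ (norm_nonneg _) (norm_nonneg _)).1 (by exact_mod_cast h1)
  have hdense : DenseRange e := by
    rw [DenseRange, ← LinearMap.coe_range, Finsupp.range_linearCombination]
    exact hu
  let T : E →L[ℂ] F := f.extendOfNorm e
  have hT : ∀ x, T (e x) = f x :=
    LinearMap.extendOfNorm_eq hdense ⟨1, fun x => by rw [hnorm, one_mul]⟩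
  refine ⟨⟨T.toLinearMap, fun x => ?_⟩⟩
  refine hdense.induction_on (p := fun x => ‖T x‖ = ‖x‖) x ?_ fun y => by rw [hT, hnorm]
  exact isClosed_eq (by fun_prop) (by fun_prop)

theorem lift_hilbertDim_le {E : Type u} {F : Type v} [NormedAddCommGroup E]
    [InnerProductSpace ℂ E] [CompleteSpace E] [NormedAddCommGroup F] [InnerProductSpace ℂ F]
    [CompleteSpace F] (T : E →ₗᵢ[ℂ] F) :
    Cardinal.lift.{v} (hilbertDim E) ≤ Cardinal.lift.{u} (hilbertDim F) := by
  obtain ⟨b, -⟩ := (exists_hilbertBasis ℂ E).choose_spec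
  obtain ⟨b', -⟩ := (exists_hilbertBasis ℂ F).choose_spec
  exact lift_mk_orthonormal_le b' (b.orthonormal.comp_linearIsometry T)

variable {Ω : Type w} [MeasurableSpace Ω]
  {H : Type u} [NormedAddCommGroup H] [InnerProductSpace ℂ H]
  {K : Type v} [NormedAddCommGroup K] [InnerProductSpace ℂ K]

theorem idTensor_mul (A B : K →L[ℂ] K) : idTensor H (A * B) = idTensor H A * idTensor H B := by
  ext x
  refine htensor_induction (p := fun x => idTensor H (A * B) x = idTensor H A (idTensor H B x))
    ?_ (by simp) ?_ ?_ x
  · exact isClosed_eq (by fun_prop) (by fun_prop)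
  · intro x y hx hy
    simp only [map_add, hx, hy]
  · intro φ k
    simp only [idTensor_coe_tmul, mul_apply_eq_comp]

variable [CompleteSpace K]

/-- The partial inner product `H ⊗ K → K` with a vector of `H`. -/
def slice (φ : H) : HTensor H K →L[ℂ] K :=
  (UniformSpace.Completion.toComplL ∘L TensorProduct.mkL ℂ H K φ)†

theorem inner_slice (φ : H) (k : K) (x : HTensor H K) : ⟪k, slice φ x⟫_ℂ = ⟪htmul φ k, x⟫_ℂ :=
  ContinuousLinearMap.adjoint_inner_right _ _ _

theorem slice_idTensor {A : K →L[ℂ] K} (hA : ∀ k l, ⟪A k, l⟫_ℂ = ⟪k, A l⟫_ℂ) (φ : H)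
    (x : HTensor H K) : slice φ (idTensor H A x) = A (slice φ x) := by
  refine ext_inner_left ℂ fun k => ?_
  rw [inner_slice, ← inner_idTensor hA, idTensor_coe_tmul, ← hA, inner_slice]

theorem eq_zero_of_slice {φ : ℕ → H} (hφ : DenseRange φ) {x : HTensor H K}
    (h : ∀ i, slice (φ i) x = 0) : x = 0 := by
  refine eq_zero_of_inner_htmul fun ψ k => ?_
  refine hφ.induction_on (p := fun ψ => ⟪htmul ψ k, x⟫_ℂ = 0) ψ ?_ fun i => ?_
  · have : Continuous fun ψ : H => htmul ψ k := (tensorVec H k).continuous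
    exact isClosed_eq (this.inner continuous_const) continuous_const
  · rw [← inner_slice, h, inner_zero_right]

variable [CompleteSpace H]

/-- A normal `M`-measurement has countably many vectors in the space of the apparatus whose null
sets with respect to the pointer observable are those of `M`. -/
theorem IsNormalMeasurement.exists_separating [TopologicalSpace.SeparableSpace H]
    {M : Set Ω → H →L[ℂ] H} {P : Set Ω → K →L[ℂ] K} {U : HTensor H K →L[ℂ] HTensor H K} {ξ : K}
    (h : IsNormalMeasurement M P U ξ) :
    ∃ k : ℕ → K, ∀ X, MeasurableSet X → (M X = 0 ↔ ∀ n, P X (k n) = 0) := by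
  let φ := TopologicalSpace.denseSeq H
  have hφ : DenseRange φ := TopologicalSpace.denseRange_denseSeq H
  let ψ : ℕ → HTensor H K := fun j => U (tensorVec H ξ (φ j))
  refine ⟨fun n => slice (φ n.unpair.1) (ψ n.unpair.2), fun X hX => ?_⟩
  have hP := h.sharp.isStarProjection X hX
  have hsymm : ∀ k l, ⟪P X k, l⟫_ℂ = ⟪k, P X l⟫_ℂ := (h.sharp.isPositive X hX).isSymmetric
  have hM : ∀ j, M X (φ j) = ((tensorVec H ξ)†) ((U†) (idTensor H (P X) (ψ j))) := by
    intro j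
    rw [h.reproduces X hX]
    rfl
  -- The identity behind this is `⟪φ j, M X (φ j)⟫ = ‖(1 ⊗ P X) (ψ j)‖²`.
  have hzero : M X = 0 ↔ ∀ j, idTensor H (P X) (ψ j) = 0 := by
    refine ⟨fun h0 j => ?_, fun h0 => ?_⟩
    · have h1 : ⟪φ j, M X (φ j)⟫_ℂ = 0 := by simp [h0]
      rw [hM, ContinuousLinearMap.adjoint_inner_right, ContinuousLinearMap.adjoint_inner_right,
        ← hP.isIdempotentElem.eq, idTensor_mul] at h1
      rw [mul_apply_eq_comp, ← inner_idTensor hsymm] at h1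
      exact inner_self_eq_zero.1 h1
    · ext x
      refine hφ.induction_on (p := fun x => M X x = 0) x ?_ fun j => ?_
      · exact isClosed_eq (by fun_prop) continuous_const
      · rw [hM, h0, map_zero, map_zero]
  rw [hzero]
  simp only [← slice_idTensor hsymm]
  refine ⟨fun h0 n => by rw [h0, map_zero], fun h0 j => eq_zero_of_slice hφ fun i => ?_⟩
  simpa using h0 (Nat.pair i j)

/-- If countably many vectors separate a projection valued measure from `μ`, then `L²(μ)` embeds
isometrically into its Hilbert space. -/
theorem IsSharpObservable.exists_linearIsometry {P : Set Ω → K →L[ℂ] K} (hP : IsSharpObservable P)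
    (μ : Measure Ω) [IsProbabilityMeasure μ] {k : ℕ → K}
    (hk : ∀ X, MeasurableSet X → (μ X = 0 ↔ ∀ n, P X (k n) = 0)) :
    Nonempty (Lp ℂ 2 μ →ₗᵢ[ℂ] K) := by
  have hd : ∀ n, ∃ d : Ω → ℝ, Measurable d ∧ Integrable d μ ∧ 0 ≤ᵐ[μ] d ∧
      ∀ X, MeasurableSet X → ((∫ x in X, d x ∂μ : ℝ) : ℂ) = ⟪k n, P X (k n)⟫_ℂ := by
    intro n
    obtain ⟨d, hdm, hdi, hdX⟩ := hP.exists_density μ (k n) (k n) fun X hX h0 => by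
      rw [(hk X hX).1 h0 n, inner_zero_right]
    have hX : ∀ X, MeasurableSet X → ∫ x in X, (d x).re ∂μ = (⟪k n, P X (k n)⟫_ℂ).re := by
      intro X hX
      rw [← hdX X hX]
      exact integral_re hdi.restrict
    refine ⟨fun x => (d x).re, by fun_prop, hdi.re, ?_, fun X hXm => ?_⟩
    · refine ae_nonneg_of_forall_setIntegral_nonneg hdi.re fun X hXm _ => ?_
      exact (hX X hXm).symm ▸ (hP.isPositive X hXm).re_inner_nonneg_right _
    · rw [hX X hXm]
      refine Complex.conj_eq_iff_re.1 ?_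
      rw [inner_conj_symm]
      exact (hP.isPositive X hXm).isSymmetric _ _
  choose d hdm hdi hd0 hdX using hd
  let A : ℕ → Set Ω := disjointed fun n => {x | 0 < d n x}
  have hA : ∀ n, MeasurableSet (A n) :=
    MeasurableSet.disjointed fun n => measurableSet_lt measurable_const (hdm n)
  have hAd : Pairwise fun i j => Disjoint (A i) (A j) := disjoint_disjointed _
  have hApos : ∀ n x, x ∈ A n → 0 < d n x := fun n x hx => disjointed_subset _ n hx
  have hfull : ∀ᵐ x ∂μ, ∃ n, x ∈ A n := by
    have hC : MeasurableSet (⋃ n, A n)ᶜ := (MeasurableSet.iUnion hA).compl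
    have h0 : μ (⋃ n, A n)ᶜ = 0 := by
      -- Off the union every `d n` vanishes almost everywhere, so `‖P C (k n)‖² = 0` for the
      -- complement `C`, and separation gives `μ C = 0`.
      refine (hk _ hC).2 fun n => ?_
      have h1 : ∫ x in (⋃ n, A n)ᶜ, d n x ∂μ = 0 := by
        refine setIntegral_eq_zero_of_ae_eq_zero ?_
        filter_upwards [hd0 n] with x hx hxC
        refine le_antisymm ?_ hx
        by_contra hlt
        refine hxC ?_
        rw [iUnion_disjointed]
        exact Set.mem_iUnion.2 ⟨n, not_le.1 hlt⟩
      have h2 := hdX n _ hC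
      rw [h1, Complex.ofReal_zero, ← Set.inter_self (⋃ n, A n)ᶜ,
        ← hP.inner_apply_apply hC hC] at h2
      exact inner_self_eq_zero.1 h2.symm
    filter_upwards [measure_eq_zero_iff_ae_notMem.1 h0] with x hx
    simpa using hx
  have hg : ∀ n, MemLp (fun x => ((√(d n x) : ℝ) : ℂ)) 2 μ := by
    intro n
    have hmeas : AEStronglyMeasurable (fun x => ((√(d n x) : ℝ) : ℂ)) μ :=
      (Complex.measurable_ofReal.comp (hdm n).sqrt).aestronglyMeasurable
    rw [memLp_two_iff_integrable_sq_norm hmeas]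
    refine (hdi n).congr ?_
    filter_upwards [hd0 n] with x hx
    rw [Complex.norm_real, Real.norm_of_nonneg (Real.sqrt_nonneg _), Real.sq_sqrt hx]
  let S := ℕ × {X : Set Ω // MeasurableSet X}
  let u : S → Lp ℂ 2 μ := fun p => canonicalPVM μ (p.2 ∩ A p.1) ((hg p.1).toLp _)
  let u' : S → K := fun p => P (p.2 ∩ A p.1) (k p.1)
  have hm : ∀ p : S, MeasurableSet (p.2 ∩ A p.1) := fun p => p.2.2.inter (hA p.1)
  have hcan := canonicalPVM_isSharpObservable μ
  refine exists_linearIsometry_of_gram (u := u) (u' := u') ?_ ?_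
  · rintro p q
    change ⟪canonicalPVM μ _ _, canonicalPVM μ _ _⟫_ℂ = ⟪P _ _, P _ _⟫_ℂ
    rw [hcan.inner_apply_apply (hm p) (hm q), hP.inner_apply_apply (hm p) (hm q)]
    have hX := (hm p).inter (hm q)
    -- For equal indices both sides integrate `d n` over the same set; for different ones the sets
    -- are disjoint.
    by_cases hpq : p.1 = q.1
    · rw [← hpq, ← hdX p.1 _ (hpq ▸ hX), inner_canonicalPVM μ (hpq ▸ hX), ← integral_complex_ofReal]
      refine integral_congr_ae (ae_restrict_of_ae ?_)
      filter_upwards [(hg p.1).coeFn_toLp, hd0 p.1] with x hx hx0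
      rw [hx, RCLike.inner_apply, Complex.conj_ofReal, ← Complex.ofReal_mul,
        Real.mul_self_sqrt hx0]
    · have hempty : (p.2 ∩ A p.1 ∩ (q.2 ∩ A q.1) : Set Ω) = ∅ := by
        refine Set.eq_empty_of_forall_notMem fun x hx => ?_
        exact Set.disjoint_left.1 (hAd hpq) hx.1.2 hx.2.2
      rw [hempty, hP.empty, hcan.empty]
      simp
  · rw [Submodule.dense_iff_topologicalClosure_eq_top,
      Submodule.topologicalClosure_eq_top_iff, Submodule.eq_bot_iff]
    intro f hf
    -- Orthogonality to every `χ_{X ∩ A n} √(d n)` forces `√(d n) f = 0` almost everywhere on `A n`,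
    -- where `d n > 0`.
    have hf0 : ∀ n, ∀ᵐ x ∂μ, x ∈ A n → f x = 0 := by
      intro n
      have hint : Integrable (fun x => ⟪((hg n).toLp _ : Lp ℂ 2 μ) x, f x⟫_ℂ) μ :=
        L2.integrable_inner _ _
      have h1 : ∀ᵐ x ∂μ, x ∈ A n → ⟪((hg n).toLp _ : Lp ℂ 2 μ) x, f x⟫_ℂ = 0 := by
        rw [← ae_restrict_iff' (hA n)]
        refine hint.restrict.ae_eq_zero_of_forall_setIntegral_eq_zero fun X hX _ => ?_
        rw [Measure.restrict_restrict hX]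
        have h2 := (Submodule.mem_orthogonal _ _).1 hf _
          (Submodule.subset_span ⟨(⟨n, X, hX⟩ : S), rfl⟩)
        rw [← inner_canonicalPVM μ (hX.inter (hA n)), ← h2]
        exact ((hcan.isPositive _ (hX.inter (hA n))).isSymmetric _ _).symm
      filter_upwards [h1, (hg n).coeFn_toLp] with x h2 h3 hx
      have h4 := h2 hx
      rw [h3, RCLike.inner_apply, Complex.conj_ofReal] at h4
      have h5 : ((√(d n x) : ℝ) : ℂ) ≠ 0 :=
        Complex.ofReal_ne_zero.2 (Real.sqrt_pos.2 (hApos n x hx)).ne'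
      simpa [h5] using h4
    refine Lp.ext ?_
    filter_upwards [ae_all_iff.2 hf0, hfull, Lp.coeFn_zero ℂ 2 μ] with x h1 ⟨n, hn⟩ h2
    rw [h1 n hn, h2, Pi.zero_apply]

end Dimension

end QMeas

end

theorem mainTheorem6
    {Ω : Type w} [MeasurableSpace Ω]
    {H : Type u} [NormedAddCommGroup H] [InnerProductSpace ℂ H] [CompleteSpace H]
    [TopologicalSpace.SeparableSpace H]
    (M : Set Ω → H →L[ℂ] H) (hM : IsObservable M)
    (μ : Measure Ω) [IsProbabilityMeasure μ] (hμM : MutuallyAC μ M) :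
    (∃ (U : HTensor H (Lp ℂ 2 μ) →L[ℂ] HTensor H (Lp ℂ 2 μ)) (ξ : Lp ℂ 2 μ),
      IsNormalMeasurement M (canonicalPVM μ) U ξ) ∧
    ∀ (K : Type v) [NormedAddCommGroup K] [InnerProductSpace ℂ K] [CompleteSpace K]
      (P : Set Ω → K →L[ℂ] K) (U : HTensor H K →L[ℂ] HTensor H K) (ξ : K),
      IsNormalMeasurement M P U ξ →
        Cardinal.lift.{v} (hilbertDim (Lp ℂ 2 μ)) ≤ Cardinal.lift.{w} (hilbertDim K) := by
  have hμ : ∀ X, MeasurableSet X → μ X = 0 → M X = 0 := fun X hX => (hμM X hX).1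
  refine ⟨hM.exists_isNormalMeasurement μ hμ, fun K _ _ _ P U ξ h => ?_⟩
  obtain ⟨k, hk⟩ := h.exists_separating
  obtain ⟨T⟩ := h.sharp.exists_linearIsometry μ fun X hX => (hμM X hX).trans (hk X hX)
  exact lift_hilbertDim_le T
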